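/- Let $m=(m_0,m_1,\dots)$ be a sequence of integers $m_j\ge 2$, let $G_m=\prod_{j\ge 0}\mathbb{Z}/m_j\mathbb{Z}$ with its normalized Haar measure $\mu$ (the product of the uniform measures), and put $M_0=1$, $M_{k+1}=m_kM_k$. Let $\mathcal F_n$ be the $\sigma$-algebra generated by the sets $I_n(x)=\{y\in G_m: y_0=x_0,\dots,y_{n-1}=x_{n-1}\}$, $x\in G_m$. For $n=\sum_k n_kM_k$ with $0\le n_k<m_k$ let $\psi_n(x)=\prod_k \exp(2\pi i x_k/m_k)^{n_k}$ be the Vilenkin functions. For $0<p\le 1$ the space $H_p(G_m)$ consists of the complex martingales $f=(f_n)_{n\in\mathbb N}$ with respect to $(\mathcal F_n)$ with $\|f\|_{H_p}:=\big(\int_{G_m}(\sup_n|f_n|)^p\,d\mu\big)^{1/p}<\infty$. For a martingale $f$ put $\widehat f(i)=\lim_{k\to\infty}\int_{G_m} f_k\overline{\psi_i}\,d\mu$ and $S_nf=\sum_{i=0}^{n-1}\widehat f(i)\psi_i$. An integrable function $g$, with partial sums $S_ng=\sum_{i=0}^{n-1}\big(\int_{G_m} g\overline{\psi_i}\,d\mu\big)\psi_i$,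 is identified with the martingale $(S_{M_j}g)_{j\in\mathbb N}$. Finally put $$\omega\Big(\frac1{M_k},f\Big)_{H_p}=\|f-S_{M_k}f\|_{H_p}.$$ Theorem 2. Let $0<p\le 1$ and, if $p<1$, assume that $G_m$ is a bounded Vilenkin group, that is, $m_j\le B$ for all $j$ and some integer $B$. Then there is a constant $c>0$, depending only on $p$ and (if $p<1$) on the bound $B$, such that for all $f\in H_p(G_m)$ and all $k\ge 0$ and $n$ with $M_k<n\le M_{k+1}$ $$\|S_nf-f\|_{H_p(G_m)}\le c\,n^{1/p-1}(\log n)^{[p]}\,\omega\Big(\frac1{M_k},f\Big)_{H_p(G_m)},$$ where $[p]$ is the integer part of $p$. -/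

import Mathlib

open MeasureTheory ProbabilityTheory Filter
open scoped ENNReal ComplexConjugate

namespace Vilenkin

/-- The Vilenkin group `G_m`: the complete direct product of the cyclic groups `ZMod (m j)`. Each
factor carries the discrete topology and sigma-algebra, and the product carries the product ones. -/
abbrev Group (m : ℕ → ℕ) : Type := (j : ℕ) → ZMod (m j)

/-- The product of the uniform probability measures on the factors, that is, the normalized Haar
measure of `G_m`. -/
noncomputable def haar (m : ℕ → ℕ) [∀ j, NeZero (m j)] : Measure (Group m) :=
  Measure.infinitePi fun j => uniformOn (Set.univ : Set (ZMod (m j)))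

/-- The interval `I_n(x)` of all points whose first `n` coordinates agree with those of `x`. -/
def interval (m : ℕ → ℕ) (n : ℕ) (x : Group m) : Set (Group m) := {y | ∀ j < n, y j = x j}

theorem finite_range_interval (m : ℕ → ℕ) [∀ j, NeZero (m j)] (n : ℕ) :
    (Set.range (interval m n)).Finite := by
  classical
  let F : ((j : Fin n) → ZMod (m j)) → Set (Group m) := fun z => {y | ∀ j : Fin n, y j = z j}
  refine (Set.finite_range F).subset ?_
  rintro _ ⟨x, rfl⟩
  refine ⟨fun j => x j, ?_⟩
  ext y
  exact ⟨fun h j hj => h ⟨j, hj⟩, fun h j => h j j.2⟩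

theorem measurableSet_interval (m : ℕ → ℕ) (n : ℕ) (x : Group m) :
    MeasurableSet (interval m n x) := by
  have h : interval m n x = ⋂ j, ⋂ (_ : j < n), (fun y : Group m => y j) ⁻¹' {x j} := by
    ext y
    simp [interval]
  rw [h]
  exact MeasurableSet.iInter fun j => MeasurableSet.iInter fun _ =>
    measurable_pi_apply j (measurableSet_singleton (x j))

/-- The filtration whose `n`-th sigma-algebra is generated by the intervals `I_n(x)`. -/
def filtration (m : ℕ → ℕ) [∀ j, NeZero (m j)] :
    Filtration ℕ (inferInstance : MeasurableSpace (Group m)) where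
  seq n := MeasurableSpace.generateFrom (Set.range (interval m n))
  mono' := by
    intro i j hij
    refine MeasurableSpace.generateFrom_le ?_
    rintro _ ⟨x, rfl⟩
    have h : interval m i x = ⋃₀ {s ∈ Set.range (interval m j) | s ⊆ interval m i x} := by
      ext y
      constructor
      · intro hy
        refine ⟨interval m j y, ⟨⟨y, rfl⟩, ?_⟩, fun l _ => rfl⟩
        intro z hz l hl
        exact (hz l (hl.trans_le hij)).trans (hy l hl)
      · rintro ⟨s, ⟨_, hs⟩, hy⟩
        exact hs hy
    rw [h]
    exact MeasurableSet.sUnion ((finite_range_interval m j).subset fun s hs => hs.1).countable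
      fun s hs => MeasurableSpace.measurableSet_generateFrom hs.1
  le' n := by
    refine MeasurableSpace.generateFrom_le ?_
    rintro _ ⟨x, rfl⟩
    exact measurableSet_interval m n x

/-- The generalized powers `M_0 = 1`, `M_{k+1} = m_k M_k`. -/
def M (m : ℕ → ℕ) : ℕ → ℕ
  | 0 => 1
  | k + 1 => m k * M m k

/-- The `k`-th digit `n_k` of `n` in the expansion `n = ∑ n_k M_k`, `0 ≤ n_k < m_k`. -/
def digit (m : ℕ → ℕ) (n k : ℕ) : ℕ := n / M m k % m k

/-- The generalized Rademacher function `r_k(x) = exp (2 π i x_k / m_k)`. -/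
noncomputable def rademacher (m : ℕ → ℕ) (k : ℕ) (x : Group m) : ℂ :=
  Complex.exp (2 * Real.pi * Complex.I * ((x k).val : ℂ) / (m k : ℂ))

/-- The Vilenkin function `ψ_n = ∏ r_k ^ n_k`. Only the factors with `k < n` are written: since
`n < M_n`, all digits `n_k` with `n ≤ k` vanish (`digit_eq_zero`). -/
noncomputable def psi (m : ℕ → ℕ) (n : ℕ) (x : Group m) : ℂ :=
  ∏ k ∈ Finset.range n, rademacher m k x ^ digit m n k

theorem digit_eq_zero (m : ℕ → ℕ) (hm : ∀ j, 2 ≤ m j) {n k : ℕ} (h : n ≤ k) :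
    digit m n k = 0 := by
  have hM : ∀ l, l < M m l := by
    intro l
    induction l with
    | zero => simp [M]
    | succ l ih =>
      have := Nat.mul_le_mul_right (M m l) (hm l)
      simp only [M]
      omega
  simp [digit, Nat.div_eq_of_lt (h.trans_lt (hM k))]

section

variable (m : ℕ → ℕ) [∀ j, NeZero (m j)]

/-- Vilenkin-Fourier coefficients of an integrable function. -/
noncomputable def coeff (g : Group m → ℂ) (i : ℕ) : ℂ :=
  ∫ x, g x * conj (psi m i x) ∂(haar m)

/-- Partial sums `S_n g` of the Vilenkin-Fourier series of an integrable function. -/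
noncomputable def partialSum (n : ℕ) (g : Group m → ℂ) (x : Group m) : ℂ :=
  ∑ i ∈ Finset.range n, coeff m g i * psi m i x

/-- The martingale `(S_{M_j} g)_j` obtained from an integrable function `g`. -/
noncomputable def toMartingale (g : Group m → ℂ) (j : ℕ) : Group m → ℂ :=
  partialSum m (M m j) g

/-- Vilenkin-Fourier coefficients of a martingale: `lim_k ∫ f_k conj(ψ_i)`. -/
noncomputable def martingaleCoeff (f : ℕ → Group m → ℂ) (i : ℕ) : ℂ :=
  limUnder atTop fun k => ∫ x, f k x * conj (psi m i x) ∂(haar m)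

/-- Partial sums `S_n f` of the Vilenkin-Fourier series of a martingale, as functions. -/
noncomputable def martingalePartialSum (n : ℕ) (f : ℕ → Group m → ℂ) (x : Group m) : ℂ :=
  ∑ i ∈ Finset.range n, martingaleCoeff m f i * psi m i x

/-- The maximal function `f^* = sup_n |f_n|`. -/
noncomputable def maximal (f : ℕ → Group m → ℂ) (x : Group m) : ℝ≥0∞ := ⨆ n, ‖f n x‖ₑ

/-- The quasinorm `‖f‖_{H_p} = ‖f^*‖_p` (possibly infinite). -/
noncomputable def hardyNorm (p : ℝ) (f : ℕ → Group m → ℂ) : ℝ≥0∞ :=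
  (∫⁻ x, maximal m f x ^ p ∂(haar m)) ^ (1 / p)

/-- Membership in the martingale Hardy space `H_p(G_m)`. -/
def MemHardy (p : ℝ) (f : ℕ → Group m → ℂ) : Prop :=
  Martingale f (filtration m) (haar m) ∧ hardyNorm m p f < ∞

/-- The modulus of continuity `ω(1/M_k, f)_{H_p} = ‖f - S_{M_k} f‖_{H_p}`. -/
noncomputable def modulus (p : ℝ) (k : ℕ) (f : ℕ → Group m → ℂ) : ℝ≥0∞ :=
  hardyNorm m p (f - toMartingale m (martingalePartialSum m (M m k) f))

end

end Vilenkin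

/-!
Put `g = f - S_{M_k} f`. For `M_k < n ≤ M_{k+1}` the terms of `S_n f - f` vanish up to `j = k` and
equal `S_n g_{k+1} - g_j` afterwards, so `‖S_n f - f‖_{H_p}` is controlled by
`‖S_n g_{k+1}‖_p` and `‖g‖_{H_p}`. Here `S_n g_{k+1} = g_{k+1} * D_n` is a convolution of functions
of the first `k + 1` coordinates, and for such functions `(∫ |φ|) ^ p ≤ M_{k+1} ^ (1 - p) ∫ |φ| ^ p`
by a pointwise bound on the atoms `I_{k+1}(x)`. Hence Fubini gives
`‖S_n g_{k+1}‖_p ^ p ≤ M_{k+1} ^ (1 - p) ‖D_n‖_p ^ p ‖g‖_{H_p} ^ p`.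

The kernel satisfies `|D_n| ≤ n` everywhere and `|D_n(x)| ≤ M_{j+1} / |x_j|` on the annulus
`I_j(0) \ I_{j+1}(0)`, where `|x_j|` is the distance from `x_j` to `0` in the cyclic group. Taking
the geometric mean `|D_n| ^ p ≤ n ^ (p - q) (M_{j+1} / |x_j|) ^ q` with `q < 1` makes the sum over
the annuli telescope, so that `∫ |D_n| ^ p ≤ 5 / (1 - q) * n ^ (p - q)`. The choice `q = p` settles
`p < 1`, and `q = 1 - 1 / (1 + log n)` yields the logarithm for `p = 1`. In a bounded group
`M_{k+1}` is comparable with `n`.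
-/

namespace Vilenkin

section Powers

variable {m : ℕ → ℕ}

theorem M_dvd_M (m : ℕ → ℕ) {j k : ℕ} (h : j ≤ k) : M m j ∣ M m k := by
  induction k, h using Nat.le_induction with
  | base => exact dvd_rfl
  | succ k _ ih => exact ih.mul_left (m k)

theorem M_eq_prod (m : ℕ → ℕ) (k : ℕ) : M m k = ∏ j ∈ Finset.range k, m j := by
  induction k with
  | zero => simp [M]
  | succ k ih => rw [Finset.prod_range_succ, ← ih, M, mul_comm]

theorem lt_M (hm : ∀ j, 2 ≤ m j) (k : ℕ) : k < M m k := by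
  induction k with
  | zero => simp [M]
  | succ k ih =>
    have := Nat.mul_le_mul_right (M m k) (hm k)
    rw [M]
    omega

theorem mul_M_add_lt {a i k : ℕ} (ha : a < m k) (hi : i < M m k) :
    a * M m k + i < M m (k + 1) := by
  have := Nat.mul_le_mul_right (M m k) (Nat.succ_le_of_lt ha)
  rw [Nat.succ_mul] at this
  rw [M]
  omega

theorem digit_injective (hm : ∀ j, 2 ≤ m j) : Function.Injective (digit m) := by
  intro i l hil
  have hdiv : ∀ n k, n / M m k = m k * (n / M m (k + 1)) + digit m n k := fun n k => by
    rw [digit, M, mul_comm (m k) (M m k), ← Nat.div_div_eq_div_mul, Nat.div_add_mod]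
  have hquot : ∀ k ≤ max i l, i / M m k = l / M m k := by
    intro k hk
    induction hk using Nat.decreasingInduction with
    | self =>
      have hlt := lt_M hm (max i l)
      rw [Nat.div_eq_of_lt ((le_max_left i l).trans_lt hlt),
        Nat.div_eq_of_lt ((le_max_right i l).trans_lt hlt)]
    | of_succ k _ ih => rw [hdiv i, hdiv l, ih, hil]
  simpa [M] using hquot 0 (Nat.zero_le _)

variable [∀ j, NeZero (m j)]

theorem M_pos (m : ℕ → ℕ) [∀ j, NeZero (m j)] (k : ℕ) : 0 < M m k := by
  induction k with
  | zero => simp [M]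
  | succ k ih => exact Nat.mul_pos (NeZero.pos (m k)) ih

theorem M_mono (m : ℕ → ℕ) [∀ j, NeZero (m j)] : Monotone (M m) := fun _ k h =>
  Nat.le_of_dvd (M_pos m k) (M_dvd_M m h)

theorem digit_eq_zero_of_lt {n k j : ℕ} (h : n < M m k) (hj : k ≤ j) : digit m n j = 0 := by
  simp [digit, Nat.div_eq_of_lt (h.trans_le (M_mono m hj))]

theorem digit_mul_add_of_lt {a i j k : ℕ} (hj : j < k) :
    digit m (a * M m k + i) j = digit m i j := by
  obtain ⟨q, hq⟩ := M_dvd_M m (Nat.succ_le_of_lt hj)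
  have h : a * M m k + i = i + M m j * (m j * (a * q)) := by
    rw [hq, M]
    ring
  rw [digit, digit, h, Nat.add_mul_div_left _ _ (M_pos m j), Nat.add_mul_mod_self_left]

theorem digit_mul_add_self {a i k : ℕ} (ha : a < m k) (hi : i < M m k) :
    digit m (a * M m k + i) k = a := by
  rw [digit, add_comm, Nat.add_mul_div_right _ _ (M_pos m k), Nat.div_eq_of_lt hi, zero_add,
    Nat.mod_eq_of_lt ha]

end Powers

section VilenkinFunctions

variable {m : ℕ → ℕ} [∀ j, NeZero (m j)]

theorem rademacher_eq_stdAddChar (k : ℕ) (x : Group m) :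
    rademacher m k x = ZMod.stdAddChar (x k) := by
  rw [ZMod.stdAddChar_apply, ZMod.toCircle_apply]
  rfl

theorem norm_rademacher (k : ℕ) (x : Group m) : ‖rademacher m k x‖ = 1 := by
  rw [rademacher_eq_stdAddChar, AddChar.norm_apply]

theorem norm_psi (n : ℕ) (x : Group m) : ‖psi m n x‖ = 1 := by
  simp only [psi, norm_prod, norm_pow, norm_rademacher, one_pow, Finset.prod_const_one]

theorem psi_sub (n : ℕ) (x y : Group m) : psi m n (x - y) = psi m n x * conj (psi m n y) := by
  have h : ∀ k, rademacher m k (x - y) = rademacher m k x * conj (rademacher m k y) := fun k => by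
    rw [rademacher_eq_stdAddChar, rademacher_eq_stdAddChar, rademacher_eq_stdAddChar, Pi.sub_apply,
      sub_eq_add_neg, AddChar.map_add_eq_mul, AddChar.map_neg_eq_conj]
  simp only [psi, h, map_prod, map_pow, mul_pow, Finset.prod_mul_distrib]

theorem measurable_psi (n : ℕ) : Measurable (psi m n) := by
  refine Finset.measurable_fun_prod _ fun k _ => ?_
  simp only [rademacher_eq_stdAddChar]
  exact ((measurable_of_countable _).comp (measurable_pi_apply k)).pow_const _

theorem psi_eq_prod (hm : ∀ j, 2 ≤ m j) {n K : ℕ} (h : n < M m K) (x : Group m) :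
    psi m n x = ∏ k ∈ Finset.range K, rademacher m k x ^ digit m n k := by
  rcases le_total n K with hK | hK
  · refine Finset.prod_subset (Finset.range_mono hK) fun k _ hk => ?_
    rw [digit_eq_zero m hm (by simpa using hk), pow_zero]
  · refine (Finset.prod_subset (Finset.range_mono hK) fun k _ hk => ?_).symm
    rw [digit_eq_zero_of_lt h (by simpa using hk), pow_zero]

theorem psi_mul_add (hm : ∀ j, 2 ≤ m j) {a i k : ℕ} (ha : a < m k) (hi : i < M m k)
    (x : Group m) :
    psi m (a * M m k + i) x = rademacher m k x ^ a * psi m i x := by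
  rw [psi_eq_prod hm (mul_M_add_lt ha hi), Finset.prod_range_succ, digit_mul_add_self ha hi,
    psi_eq_prod hm hi, mul_comm]
  congr 1
  exact Finset.prod_congr rfl fun j hj => by rw [digit_mul_add_of_lt (Finset.mem_range.1 hj)]

theorem dependsOn_psi (hm : ∀ j, 2 ≤ m j) {n K : ℕ} (h : n < M m K) :
    DependsOn (psi m n) (Set.Iio K) := by
  intro x y hxy
  rw [psi_eq_prod hm h, psi_eq_prod hm h]
  refine Finset.prod_congr rfl fun j hj => ?_
  rw [rademacher_eq_stdAddChar, rademacher_eq_stdAddChar, hxy j (Finset.mem_range.1 hj)]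

theorem psi_single (hm : ∀ j, 2 ≤ m j) (n k : ℕ) :
    psi m n (Pi.single k 1) = ZMod.stdAddChar (digit m n k : ZMod (m k)) := by
  have hself : rademacher m k (Pi.single k 1) ^ digit m n k =
      ZMod.stdAddChar (digit m n k : ZMod (m k)) := by
    rw [rademacher_eq_stdAddChar, Pi.single_eq_same, ← AddChar.map_nsmul_eq_pow, nsmul_one]
  rw [psi, ← hself]
  refine Finset.prod_eq_single k (fun j _ hj => ?_) fun hk => ?_
  · rw [rademacher_eq_stdAddChar, Pi.single_eq_of_ne hj, AddChar.map_zero_eq_one, one_pow]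
  · rw [digit_eq_zero m hm (by simpa using hk), pow_zero]

theorem psi_injective (hm : ∀ j, 2 ≤ m j) : Function.Injective (psi m) := by
  intro i l hil
  refine digit_injective hm (funext fun k => ?_)
  have hcast : (digit m i k : ZMod (m k)) = digit m l k := ZMod.injective_stdAddChar <| by
    rw [← psi_single hm, ← psi_single hm, hil]
  have hlt : ∀ n, digit m n k < m k := fun n => Nat.mod_lt _ (NeZero.pos (m k))
  rw [← ZMod.val_cast_of_lt (hlt i), hcast, ZMod.val_cast_of_lt (hlt l)]

end VilenkinFunctions

section HaarMeasure

variable {m : ℕ → ℕ}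

theorem sub_mem_interval_zero {K : ℕ} {x y : Group m} :
    x - y ∈ interval m K 0 ↔ y ∈ interval m K x :=
  forall₂_congr fun _ _ => sub_eq_zero.trans eq_comm

variable [∀ j, NeZero (m j)]

instance : IsProbabilityMeasure (haar m) := by
  unfold haar
  infer_instance

instance : (haar m).IsAddLeftInvariant where
  map_add_left_eq_self a := by
    have hcoord : ∀ j, (uniformOn (Set.univ : Set (ZMod (m j)))).map (a j + ·) =
        uniformOn Set.univ := fun j => by
      ext s hs
      rw [Measure.map_apply (measurable_const_add _) hs, uniformOn_univ, uniformOn_univ,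
        measure_preimage_add]
    have h := Measure.infinitePi_map_pi (fun j => uniformOn (Set.univ : Set (ZMod (m j))))
      fun j => measurable_const_add (a j)
    simp only [hcoord] at h
    exact h

theorem haar_interval (K : ℕ) (x : Group m) : haar m (interval m K x) = (M m K : ℝ≥0∞)⁻¹ := by
  have h : interval m K x = (Finset.range K : Set ℕ).pi fun j => {x j} := by
    ext y
    simp [interval]
  rw [h, haar, Measure.infinitePi_pi _ fun j _ => measurableSet_singleton _, M_eq_prod,
    Nat.cast_prod, ENNReal.prod_inv_distrib fun i _ j _ _ => Or.inr (ENNReal.natCast_ne_top _)]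
  refine Finset.prod_congr rfl fun j _ => ?_
  rw [uniformOn_univ, Measure.count_singleton, ZMod.card, one_div]

theorem measurable_of_dependsOn {α : Type*} [MeasurableSpace α] {K : ℕ} {h : Group m → α}
    (hh : DependsOn h (Set.Iio K)) : Measurable[filtration m K] h := by
  intro s _
  have hs : h ⁻¹' s = ⋃₀ {I ∈ Set.range (interval m K) | I ⊆ h ⁻¹' s} := by
    refine subset_antisymm (fun x hx => ?_) (Set.sUnion_subset fun I hI => hI.2)
    refine ⟨interval m K x, ⟨⟨x, rfl⟩, fun y hy => ?_⟩, fun _ _ => rfl⟩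
    rwa [Set.mem_preimage, hh hy]
  rw [hs]
  exact MeasurableSet.sUnion ((finite_range_interval m K).subset fun I hI => hI.1).countable
    fun I hI => MeasurableSpace.measurableSet_generateFrom hI.1

theorem dependsOn_of_measurable {α : Type*} [MeasurableSpace α] [MeasurableSingletonClass α]
    {K : ℕ} {h : Group m → α} (hh : Measurable[filtration m K] h) : DependsOn h (Set.Iio K) := by
  intro x y hxy
  have hsat : ∀ s, MeasurableSet[filtration m K] s → (x ∈ s ↔ y ∈ s) := fun s hs => by
    induction s, hs using MeasurableSpace.generateFrom_induction with
    | hC s hs =>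
      obtain ⟨z, rfl⟩ := hs
      exact forall₂_congr fun j hj => by rw [hxy j hj]
    | empty => rfl
    | compl s _ ih => exact not_congr ih
    | iUnion s _ ih => simp only [Set.mem_iUnion, ih]
  exact ((hsat _ (hh (measurableSet_singleton (h x)))).1 rfl).symm

theorem le_mul_lintegral_of_dependsOn {K : ℕ} {φ : Group m → ℝ≥0∞}
    (hφ : DependsOn φ (Set.Iio K)) (x : Group m) : φ x ≤ M m K * ∫⁻ y, φ y ∂(haar m) := by
  have hM : (M m K : ℝ≥0∞) ≠ 0 := Nat.cast_ne_zero.2 (M_pos m K).ne'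
  calc φ x = M m K * (φ x * haar m (interval m K x)) := by
        rw [haar_interval, mul_left_comm, ENNReal.mul_inv_cancel hM (ENNReal.natCast_ne_top _),
          mul_one]
    _ = M m K * ∫⁻ y in interval m K x, φ y ∂(haar m) := by
        rw [setLIntegral_congr_fun (measurableSet_interval m K x) fun y hy => hφ hy,
          setLIntegral_const]
    _ ≤ M m K * ∫⁻ y, φ y ∂(haar m) := by
        gcongr
        exact Measure.restrict_le_self

theorem rpow_lintegral_le_of_dependsOn {p : ℝ} (hp0 : 0 < p) (hp1 : p ≤ 1) {K : ℕ}
    {φ : Group m → ℝ≥0∞} (hφ : DependsOn φ (Set.Iio K)) :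
    (∫⁻ x, φ x ∂(haar m)) ^ p ≤ (M m K : ℝ≥0∞) ^ (1 - p) * ∫⁻ x, φ x ^ p ∂(haar m) := by
  set A := ∫⁻ x, φ x ^ p ∂(haar m)
  have hp : 0 ≤ 1 - p := sub_nonneg.2 hp1
  have hsup : ∀ x, φ x ≤ (M m K * A) ^ p⁻¹ := fun x => by
    rw [ENNReal.le_rpow_inv_iff hp0]
    exact le_mul_lintegral_of_dependsOn (φ := fun x => φ x ^ p)
      (fun a b hab => congrArg (· ^ p) (hφ hab)) x
  have hmeas : Measurable fun x => φ x ^ p :=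
    ((measurable_of_dependsOn hφ).mono ((filtration m).le K) le_rfl).pow_const p
  have hint : ∫⁻ x, φ x ∂(haar m) ≤ A * ((M m K * A) ^ p⁻¹) ^ (1 - p) :=
    calc ∫⁻ x, φ x ∂(haar m) = ∫⁻ x, φ x ^ p * φ x ^ (1 - p) ∂(haar m) := by
          refine lintegral_congr fun x => ?_
          rw [← ENNReal.rpow_add_of_nonneg _ _ hp0.le hp, add_sub_cancel, ENNReal.rpow_one]
      _ ≤ ∫⁻ x, φ x ^ p * ((M m K * A) ^ p⁻¹) ^ (1 - p) ∂(haar m) := by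
          gcongr with x
          exact hsup x
      _ = A * ((M m K * A) ^ p⁻¹) ^ (1 - p) := lintegral_mul_const _ hmeas
  calc (∫⁻ x, φ x ∂(haar m)) ^ p ≤ (A * ((M m K * A) ^ p⁻¹) ^ (1 - p)) ^ p := by gcongr
    _ = A ^ p * (M m K * A) ^ (1 - p) := by
        rw [ENNReal.mul_rpow_of_nonneg _ _ hp0.le, ← ENNReal.rpow_mul, ← ENNReal.rpow_mul,
          mul_comm (1 - p) p, inv_mul_cancel_left₀ hp0.ne']
    _ = (M m K : ℝ≥0∞) ^ (1 - p) * A := by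
        rw [ENNReal.mul_rpow_of_nonneg _ _ hp, mul_left_comm,
          ← ENNReal.rpow_add_of_nonneg _ _ hp0.le hp, add_sub_cancel, ENNReal.rpow_one]

end HaarMeasure

section DirichletKernel

/-- The Dirichlet kernel `∑_{a < s} exp (2 π i a t / N)` of the cyclic group `ZMod N`. -/
noncomputable def cyclicDirichlet (N : ℕ) [NeZero N] (s : ℕ) (t : ZMod N) : ℂ :=
  ∑ a ∈ Finset.range s, ZMod.stdAddChar t ^ a

theorem cyclicDirichlet_self (N : ℕ) [NeZero N] (t : ZMod N) :
    cyclicDirichlet N N t = if t = 0 then (N : ℂ) else 0 := by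
  split_ifs with h
  · simp [cyclicDirichlet, h]
  · have hne : (ZMod.stdAddChar t : ℂ) ≠ 1 := fun h1 => h
      (ZMod.injective_stdAddChar (h1.trans (AddChar.map_zero_eq_one _).symm))
    rw [cyclicDirichlet, geom_sum_eq hne, ← AddChar.map_nsmul_eq_pow]
    simp

variable {m : ℕ → ℕ} [∀ j, NeZero (m j)]

/-- The Dirichlet kernel `D_n = ∑_{i < n} ψ_i`, convolution with which is `S_n`. -/
noncomputable def dirichlet (m : ℕ → ℕ) (n : ℕ) (x : Group m) : ℂ :=
  ∑ i ∈ Finset.range n, psi m i x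

theorem measurable_dirichlet (n : ℕ) : Measurable (dirichlet m n) :=
  Finset.measurable_fun_sum _ fun i _ => measurable_psi i

theorem norm_dirichlet_le (n : ℕ) (x : Group m) : ‖dirichlet m n x‖ ≤ n :=
  (norm_sum_le _ _).trans_eq <| by simp only [norm_psi, Finset.sum_const, Finset.card_range,
    nsmul_eq_mul, mul_one]

theorem dependsOn_dirichlet (hm : ∀ j, 2 ≤ m j) {n K : ℕ} (h : n ≤ M m K) :
    DependsOn (dirichlet m n) (Set.Iio K) := fun _ _ hxy =>
  Finset.sum_congr rfl fun _ hi => dependsOn_psi hm ((Finset.mem_range.1 hi).trans_le h) hxy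

theorem dirichlet_mul_M (hm : ∀ j, 2 ≤ m j) {s k : ℕ} (hs : s ≤ m k) (x : Group m) :
    dirichlet m (s * M m k) x = cyclicDirichlet (m k) s (x k) * dirichlet m (M m k) x := by
  induction s with
  | zero => simp [dirichlet, cyclicDirichlet]
  | succ s ih =>
    have hblock : ∑ i ∈ Finset.range (M m k), psi m (s * M m k + i) x =
        ZMod.stdAddChar (x k) ^ s * dirichlet m (M m k) x := by
      rw [dirichlet, Finset.mul_sum]
      refine Finset.sum_congr rfl fun i hi => ?_
      rw [psi_mul_add hm hs (Finset.mem_range.1 hi), rademacher_eq_stdAddChar]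
    rw [Nat.succ_mul, dirichlet, Finset.sum_range_add, ← dirichlet, ih (Nat.le_of_succ_le hs),
      hblock, ← add_mul]
    simp only [cyclicDirichlet, Finset.sum_range_succ]

theorem dirichlet_mul_M_add (hm : ∀ j, 2 ≤ m j) {s k i : ℕ} (hs : s < m k) (hi : i < M m k)
    (x : Group m) :
    dirichlet m (s * M m k + i) x =
      cyclicDirichlet (m k) s (x k) * dirichlet m (M m k) x +
        rademacher m k x ^ s * dirichlet m i x := by
  rw [← dirichlet_mul_M hm hs.le, dirichlet, Finset.sum_range_add, ← dirichlet]
  simp only [dirichlet, Finset.mul_sum]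
  congr 1
  exact Finset.sum_congr rfl fun l hl =>
    psi_mul_add hm hs ((Finset.mem_range.1 hl).trans hi) x

theorem dirichlet_M (hm : ∀ j, 2 ≤ m j) (k : ℕ) (x : Group m) :
    dirichlet m (M m k) x = (interval m k 0).indicator (fun _ => (M m k : ℂ)) x := by
  classical
  induction k with
  | zero => simp [dirichlet, M, interval, psi]
  | succ k ih =>
    rw [M, dirichlet_mul_M hm le_rfl, ih, cyclicDirichlet_self]
    simp only [Set.indicator_apply, interval, Set.mem_ofPred_eq, Nat.forall_lt_succ_right,
      Pi.zero_apply]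
    split_ifs <;> simp_all

end DirichletKernel

section PartialSums

theorem lintegral_lintegral_mul_sub {G : Type*} [MeasurableSpace G] [AddGroup G]
    [MeasurableSub₂ G] [MeasurableAdd G] {μ : Measure G} [SFinite μ] [μ.IsAddRightInvariant]
    {φ χ : G → ℝ≥0∞} (hφ : Measurable φ) (hχ : Measurable χ) :
    ∫⁻ x, ∫⁻ y, φ y * χ (x - y) ∂μ ∂μ = (∫⁻ y, φ y ∂μ) * ∫⁻ x, χ x ∂μ := by
  have hprod : Measurable fun z : G × G => φ z.2 * χ (z.1 - z.2) :=
    (hφ.comp measurable_snd).mul (hχ.comp measurable_sub)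
  rw [lintegral_lintegral_swap hprod.aemeasurable, ← lintegral_mul_const _ hφ]
  refine lintegral_congr fun y => ?_
  rw [lintegral_const_mul (φ y) (f := fun x => χ (x - y)) (hχ.comp (measurable_sub_const y)),
    lintegral_sub_right_eq_self χ y]

variable {m : ℕ → ℕ} [∀ j, NeZero (m j)]

theorem integrable_psi (n : ℕ) : Integrable (psi m n) (haar m) :=
  .of_bound (measurable_psi n).aestronglyMeasurable 1 (ae_of_all _ fun x => (norm_psi n x).le)

theorem integrable_mul_conj_psi {h : Group m → ℂ} (hh : Integrable h (haar m)) (i : ℕ) :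
    Integrable (fun x => h x * conj (psi m i x)) (haar m) :=
  hh.mul_bdd (c := 1)
    (Complex.continuous_conj.measurable.comp (measurable_psi i)).aestronglyMeasurable
    (ae_of_all _ fun x => ((RCLike.norm_conj _).trans (norm_psi i x)).le)

theorem coeff_psi (hm : ∀ j, 2 ≤ m j) (l i : ℕ) :
    coeff m (psi m l) i = if l = i then 1 else 0 := by
  split_ifs with hli
  · subst hli
    simp [coeff, Complex.mul_conj', norm_psi]
  · obtain ⟨y, hy⟩ := Function.ne_iff.1 ((psi_injective hm).ne hli)
    have hinv : conj (psi m l y) * psi m i y * coeff m (psi m l) i = coeff m (psi m l) i := by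
      rw [coeff, ← integral_const_mul,
        ← integral_sub_right_eq_self (fun x => psi m l x * conj (psi m i x)) y]
      refine integral_congr_ae (ae_of_all _ fun x => ?_)
      simp only [psi_sub, map_mul, Complex.conj_conj]
      ring
    by_contra h0
    have hunit : psi m l y * conj (psi m l y) = 1 := by simp [Complex.mul_conj', norm_psi]
    have hone : conj (psi m l y) * psi m i y = 1 := (mul_eq_right₀ h0).1 hinv
    exact hy (left_inv_eq_right_inv hunit hone)

theorem partialSum_sum_psi (hm : ∀ j, 2 ≤ m j) (c : ℕ → ℂ) (N n : ℕ) :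
    partialSum m N (fun x => ∑ l ∈ Finset.range n, c l * psi m l x) =
      fun x => ∑ l ∈ Finset.range (min N n), c l * psi m l x := by
  have hcoeff : ∀ i, coeff m (fun x => ∑ l ∈ Finset.range n, c l * psi m l x) i =
      if i < n then c i else 0 := fun i => by
    simp only [coeff, Finset.sum_mul, mul_assoc]
    rw [integral_finsetSum _ fun l _ =>
      (integrable_mul_conj_psi (integrable_psi l) i).const_mul (c l)]
    simp only [integral_const_mul, ← coeff.eq_def, coeff_psi hm, mul_ite, mul_one, mul_zero,
      Finset.sum_ite_eq', Finset.mem_range]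
  funext x
  simp only [partialSum, hcoeff, ite_mul, zero_mul]
  rw [← Finset.sum_filter]
  refine Finset.sum_congr ?_ fun _ _ => rfl
  ext i
  simp

theorem partialSum_sub {g h : Group m → ℂ} (hg : Integrable g (haar m))
    (hh : Integrable h (haar m)) (n : ℕ) :
    partialSum m n (g - h) = partialSum m n g - partialSum m n h := by
  funext x
  simp only [partialSum, coeff, Pi.sub_apply, sub_mul, Finset.sum_sub_distrib,
    integral_sub (integrable_mul_conj_psi hg _) (integrable_mul_conj_psi hh _)]

theorem partialSum_eq_integral {h : Group m → ℂ} (hh : Integrable h (haar m)) (n : ℕ)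
    (x : Group m) :
    partialSum m n h x = ∫ y, h y * dirichlet m n (x - y) ∂(haar m) := by
  simp only [partialSum, coeff, ← integral_mul_const]
  rw [← integral_finsetSum _ fun i _ => (integrable_mul_conj_psi hh i).mul_const (psi m i x)]
  refine integral_congr_ae (ae_of_all _ fun y => ?_)
  simp only [dirichlet, psi_sub, Finset.mul_sum]
  exact Finset.sum_congr rfl fun i _ => by ring

theorem partialSum_M_eq_self (hm : ∀ j, 2 ≤ m j) {K : ℕ} {h : Group m → ℂ}
    (hint : Integrable h (haar m)) (hh : DependsOn h (Set.Iio K)) : partialSum m (M m K) h = h := by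
  classical
  funext x
  have hM : (M m K : ℂ) ≠ 0 := Nat.cast_ne_zero.2 (M_pos m K).ne'
  have hind : ∀ y, h y * dirichlet m (M m K) (x - y) =
      (interval m K x).indicator (fun _ => h x * M m K) y := fun y => by
    rw [dirichlet_M hm, Set.indicator_apply, Set.indicator_apply, sub_mem_interval_zero]
    split_ifs with hy
    · rw [hh hy]
    · rw [mul_zero]
  simp only [partialSum_eq_integral hint, hind]
  rw [integral_indicator_const _ (measurableSet_interval m K x), measureReal_def, haar_interval,
    ENNReal.toReal_inv, ENNReal.toReal_natCast, Complex.real_smul, Complex.ofReal_inv,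
    Complex.ofReal_natCast, mul_left_comm, inv_mul_cancel₀ hM, mul_one]

theorem lintegral_partialSum_rpow_le (hm : ∀ j, 2 ≤ m j) {p : ℝ} (hp0 : 0 < p) (hp1 : p ≤ 1)
    {K n : ℕ} (hn : n ≤ M m K) {h : Group m → ℂ} (hint : Integrable h (haar m))
    (hh : DependsOn h (Set.Iio K)) :
    ∫⁻ x, ‖partialSum m n h x‖ₑ ^ p ∂(haar m) ≤
      (M m K : ℝ≥0∞) ^ (1 - p) * (∫⁻ x, ‖dirichlet m n x‖ₑ ^ p ∂(haar m)) *
        ∫⁻ x, ‖h x‖ₑ ^ p ∂(haar m) := by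
  have hdep : ∀ x, DependsOn (fun y => ‖h y * dirichlet m n (x - y)‖ₑ) (Set.Iio K) :=
    fun x a b hab => by
      have hsub : dirichlet m n (x - a) = dirichlet m n (x - b) :=
        dependsOn_dirichlet hm hn fun j hj => congrArg (x j - ·) (hab j hj)
      simp only [hh hab, hsub]
  have hpoint : ∀ x, ‖partialSum m n h x‖ₑ ^ p ≤ (M m K : ℝ≥0∞) ^ (1 - p) *
      ∫⁻ y, ‖h y‖ₑ ^ p * ‖dirichlet m n (x - y)‖ₑ ^ p ∂(haar m) := fun x => by
    rw [partialSum_eq_integral hint]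
    refine (ENNReal.rpow_le_rpow (enorm_integral_le_lintegral_enorm _) hp0.le).trans ?_
    simp only [← ENNReal.mul_rpow_of_nonneg _ _ hp0.le, ← enorm_mul]
    exact rpow_lintegral_le_of_dependsOn hp0 hp1 (hdep x)
  have hMp : (M m K : ℝ≥0∞) ^ (1 - p) ≠ ∞ :=
    ENNReal.rpow_ne_top_of_nonneg (sub_nonneg.2 hp1) (ENNReal.natCast_ne_top _)
  have hmeas : Measurable fun x => ‖h x‖ₑ ^ p :=
    ((measurable_of_dependsOn hh).mono ((filtration m).le K) le_rfl).enorm.pow_const p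
  calc ∫⁻ x, ‖partialSum m n h x‖ₑ ^ p ∂(haar m)
      ≤ ∫⁻ x, (M m K : ℝ≥0∞) ^ (1 - p) *
          ∫⁻ y, ‖h y‖ₑ ^ p * ‖dirichlet m n (x - y)‖ₑ ^ p ∂(haar m) ∂(haar m) :=
        lintegral_mono hpoint
    _ = (M m K : ℝ≥0∞) ^ (1 - p) * (∫⁻ x, ‖dirichlet m n x‖ₑ ^ p ∂(haar m)) *
          ∫⁻ x, ‖h x‖ₑ ^ p ∂(haar m) := by
        rw [lintegral_const_mul' _ _ hMp, lintegral_lintegral_mul_sub hmeas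
          ((measurable_dirichlet n).enorm.pow_const p), mul_comm (∫⁻ x, ‖h x‖ₑ ^ p ∂(haar m)),
          mul_assoc]

end PartialSums

section Martingales

variable {m : ℕ → ℕ} {f : ℕ → Group m → ℂ}

theorem enorm_le_maximal (f : ℕ → Group m → ℂ) (j : ℕ) (x : Group m) :
    ‖f j x‖ₑ ≤ maximal m f x :=
  le_iSup (fun j => ‖f j x‖ₑ) j

variable [∀ j, NeZero (m j)]

theorem integral_mul_eq_of_martingale (hf : Martingale f (filtration m) (haar m)) {j k : ℕ}
    (hjk : j ≤ k) {φ : Group m → ℂ} (hφ : StronglyMeasurable[filtration m j] φ)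
    (hint : Integrable (fun x => f k x * φ x) (haar m)) :
    ∫ x, f k x * φ x ∂(haar m) = ∫ x, f j x * φ x ∂(haar m) := by
  have hpull := condExp_bilin_of_stronglyMeasurable_right (.mul ℝ ℂ) hφ hint (hf.integrable k)
  rw [← integral_condExp ((filtration m).le j)]
  refine integral_congr_ae ?_
  filter_upwards [hpull, hf.condExp_ae_eq hjk] with x hx hfx
  exact hx.trans (congrArg (· * φ x) hfx)

theorem martingaleCoeff_eq (hm : ∀ j, 2 ≤ m j) (hf : Martingale f (filtration m) (haar m))
    {i j : ℕ} (hi : i < M m j) : martingaleCoeff m f i = coeff m (f j) i := by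
  have hmeas : StronglyMeasurable[filtration m j] fun x => conj (psi m i x) :=
    Complex.continuous_conj.comp_stronglyMeasurable
      (measurable_of_dependsOn (dependsOn_psi hm hi)).stronglyMeasurable
  refine Tendsto.limUnder_eq (tendsto_const_nhds.congr' ?_)
  filter_upwards [eventually_ge_atTop j] with k hk
  exact (integral_mul_eq_of_martingale hf hk hmeas
    (integrable_mul_conj_psi (hf.integrable k) i)).symm

theorem martingale_eq_martingalePartialSum (hm : ∀ j, 2 ≤ m j)
    (hf : Martingale f (filtration m) (haar m)) (j : ℕ) :
    f j = martingalePartialSum m (M m j) f := by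
  have hself := partialSum_M_eq_self hm (hf.integrable j)
    (dependsOn_of_measurable (hf.stronglyMeasurable j).measurable)
  rw [← hself]
  funext x
  exact Finset.sum_congr rfl fun i hi => by
    rw [martingaleCoeff_eq hm hf (Finset.mem_range.1 hi), ← hself]

theorem partialSum_martingalePartialSum (hm : ∀ j, 2 ≤ m j) (f : ℕ → Group m → ℂ) (N n : ℕ) :
    partialSum m N (martingalePartialSum m n f) = martingalePartialSum m (min N n) f :=
  partialSum_sum_psi hm (martingaleCoeff m f) N n

theorem toMartingale_martingalePartialSum_of_le (hm : ∀ j, 2 ≤ m j) (f : ℕ → Group m → ℂ)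
    {n j : ℕ} (h : n ≤ M m j) :
    toMartingale m (martingalePartialSum m n f) j = martingalePartialSum m n f := by
  rw [toMartingale, partialSum_martingalePartialSum hm, min_eq_right h]

theorem toMartingale_martingalePartialSum_of_ge (hm : ∀ j, 2 ≤ m j)
    (hf : Martingale f (filtration m) (haar m)) {n j : ℕ} (h : M m j ≤ n) :
    toMartingale m (martingalePartialSum m n f) j = f j := by
  rw [toMartingale, partialSum_martingalePartialSum hm, min_eq_left h,
    ← martingale_eq_martingalePartialSum hm hf]

theorem dependsOn_martingalePartialSum (hm : ∀ j, 2 ≤ m j) (f : ℕ → Group m → ℂ) {n K : ℕ}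
    (hn : n ≤ M m K) : DependsOn (martingalePartialSum m n f) (Set.Iio K) := fun a b hab =>
  Finset.sum_congr rfl fun i hi => by
    rw [dependsOn_psi hm ((Finset.mem_range.1 hi).trans_le hn) hab]

theorem integrable_martingalePartialSum (f : ℕ → Group m → ℂ) (n : ℕ) :
    Integrable (martingalePartialSum m n f) (haar m) :=
  integrable_finsetSum _ fun i _ => (integrable_psi i).const_mul _

theorem partialSum_sub_martingalePartialSum (hm : ∀ j, 2 ≤ m j)
    (hf : Martingale f (filtration m) (haar m)) {k n : ℕ} (hkn : M m k ≤ n)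
    (hnk : n ≤ M m (k + 1)) :
    partialSum m n (f (k + 1) - martingalePartialSum m (M m k) f) =
      martingalePartialSum m n f - martingalePartialSum m (M m k) f := by
  rw [partialSum_sub (hf.integrable (k + 1)) (integrable_martingalePartialSum f _),
    martingale_eq_martingalePartialSum hm hf (k + 1), partialSum_martingalePartialSum hm,
    partialSum_martingalePartialSum hm, min_eq_left hnk, min_eq_right hkn]

theorem maximal_toMartingale_sub_le (hm : ∀ j, 2 ≤ m j)
    (hf : Martingale f (filtration m) (haar m)) {k n : ℕ} (hkn : M m k ≤ n)
    (hnk : n ≤ M m (k + 1)) (x : Group m) :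
    maximal m (toMartingale m (martingalePartialSum m n f) - f) x ≤
      ‖partialSum m n (f (k + 1) - martingalePartialSum m (M m k) f) x‖ₑ +
        maximal m (f - toMartingale m (martingalePartialSum m (M m k) f)) x := by
  refine iSup_le fun j => ?_
  rcases le_or_gt j k with hj | hj
  · rw [Pi.sub_apply, toMartingale_martingalePartialSum_of_ge hm hf ((M_mono m hj).trans hkn),
      sub_self]
    simp
  · have hsplit : (toMartingale m (martingalePartialSum m n f) - f) j =
        partialSum m n (f (k + 1) - martingalePartialSum m (M m k) f) -
          (f - toMartingale m (martingalePartialSum m (M m k) f)) j := by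
      rw [partialSum_sub_martingalePartialSum hm hf hkn hnk, Pi.sub_apply, Pi.sub_apply,
        toMartingale_martingalePartialSum_of_le hm f (hnk.trans (M_mono m hj)),
        toMartingale_martingalePartialSum_of_le hm f (M_mono m hj.le), sub_sub_sub_cancel_right]
    rw [hsplit]
    exact enorm_sub_le.trans (add_le_add le_rfl (enorm_le_maximal _ j x))

theorem hardyNorm_toMartingale_sub_le (hm : ∀ j, 2 ≤ m j) {p : ℝ} (hp0 : 0 < p) (hp1 : p ≤ 1)
    (hf : Martingale f (filtration m) (haar m)) {k n : ℕ} (hkn : M m k ≤ n)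
    (hnk : n ≤ M m (k + 1)) :
    hardyNorm m p (toMartingale m (martingalePartialSum m n f) - f) ≤
      ((M m (k + 1) : ℝ≥0∞) ^ (1 - p) * (∫⁻ x, ‖dirichlet m n x‖ₑ ^ p ∂(haar m)) + 1) ^ (1 / p) *
        modulus m p k f := by
  set h : Group m → ℂ := f (k + 1) - martingalePartialSum m (M m k) f
  set g : ℕ → Group m → ℂ := f - toMartingale m (martingalePartialSum m (M m k) f)
  have hh : h = g (k + 1) := by
    simp only [h, g, Pi.sub_apply, toMartingale_martingalePartialSum_of_le hm f
      (M_mono m k.le_succ)]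
  have hint : Integrable h (haar m) :=
    (hf.integrable (k + 1)).sub (integrable_martingalePartialSum f _)
  have hdep : DependsOn h (Set.Iio (k + 1)) := fun a b hab => by
    simp only [h, Pi.sub_apply,
      dependsOn_of_measurable (hf.stronglyMeasurable (k + 1)).measurable hab,
      dependsOn_martingalePartialSum hm f (M_mono m k.le_succ) hab]
  have hmeas : Measurable fun x => ‖partialSum m n h x‖ₑ ^ p :=
    (Finset.measurable_fun_sum _ fun i _ => (measurable_psi i).const_mul _).enorm.pow_const p
  have hconv : ∫⁻ x, ‖partialSum m n h x‖ₑ ^ p ∂(haar m) ≤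
      (M m (k + 1) : ℝ≥0∞) ^ (1 - p) * (∫⁻ x, ‖dirichlet m n x‖ₑ ^ p ∂(haar m)) *
        ∫⁻ x, maximal m g x ^ p ∂(haar m) := by
    refine (lintegral_partialSum_rpow_le hm hp0 hp1 hnk hint hdep).trans ?_
    gcongr with x
    exact hh ▸ enorm_le_maximal g (k + 1) x
  rw [modulus, hardyNorm, hardyNorm, ← ENNReal.mul_rpow_of_nonneg _ _ (by positivity), add_mul,
    one_mul]
  gcongr
  calc ∫⁻ x, maximal m (toMartingale m (martingalePartialSum m n f) - f) x ^ p ∂(haar m)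
      ≤ ∫⁻ x, (‖partialSum m n h x‖ₑ ^ p + maximal m g x ^ p) ∂(haar m) :=
        lintegral_mono fun x =>
          (ENNReal.rpow_le_rpow (maximal_toMartingale_sub_le hm hf hkn hnk x) hp0.le).trans
            (ENNReal.rpow_add_le_add_rpow _ _ hp0.le hp1)
    _ = ∫⁻ x, ‖partialSum m n h x‖ₑ ^ p ∂(haar m) + ∫⁻ x, maximal m g x ^ p ∂(haar m) :=
        lintegral_add_left hmeas _
    _ ≤ _ := by gcongr

end Martingales

section CyclicKernel

variable {N : ℕ}

theorem natAbs_valMinAbs_pos {t : ZMod N} (ht : t ≠ 0) : 0 < t.valMinAbs.natAbs :=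
  Int.natAbs_pos.2 (mt (ZMod.valMinAbs_eq_zero t).1 ht)

variable [NeZero N]

theorem two_mul_natAbs_valMinAbs_le (t : ZMod N) : 2 * t.valMinAbs.natAbs ≤ N := by
  have := ZMod.natAbs_valMinAbs_le t
  omega

theorem four_mul_div_le_norm_stdAddChar_sub_one (t : ZMod N) :
    4 * t.valMinAbs.natAbs / N ≤ ‖ZMod.stdAddChar t - 1‖ := by
  have hN : (0 : ℝ) < N := Nat.cast_pos.2 (NeZero.pos N)
  have hsmall : 2 * |(t.valMinAbs : ℝ)| ≤ N := by
    rw [← Int.cast_abs, Int.abs_eq_natAbs]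
    exact_mod_cast two_mul_natAbs_valMinAbs_le t
  have habs : |Real.pi * t.valMinAbs / N| = Real.pi * (|(t.valMinAbs : ℝ)| / N) := by
    rw [mul_div_assoc, abs_mul, abs_div, abs_of_pos Real.pi_pos, abs_of_pos hN]
  have hsin : 2 * |(t.valMinAbs : ℝ)| / N ≤ |Real.sin (Real.pi * t.valMinAbs / N)| := by
    have h := Real.mul_abs_le_abs_sin (x := Real.pi * t.valMinAbs / N) (by
      rw [habs, div_eq_mul_one_div Real.pi]
      refine mul_le_mul_of_nonneg_left ?_ Real.pi_pos.le
      rw [div_le_div_iff₀ hN two_pos]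
      linarith)
    rw [habs] at h
    convert h using 1
    field_simp
  have hexp : (ZMod.stdAddChar t : ℂ) =
      Complex.exp (Complex.I * (2 * (Real.pi * t.valMinAbs / N) : ℝ)) := by
    conv_lhs => rw [← ZMod.coe_valMinAbs t, ZMod.stdAddChar_coe]
    congr 1
    push_cast
    ring
  rw [hexp, Complex.norm_exp_I_mul_ofReal_sub_one, mul_div_cancel_left₀ _ two_ne_zero, norm_mul,
    Real.norm_two, Real.norm_eq_abs]
  calc 4 * (t.valMinAbs.natAbs : ℝ) / N = 2 * (2 * |(t.valMinAbs : ℝ)| / N) := by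
        rw [Nat.cast_natAbs, Int.cast_abs]
        ring
    _ ≤ 2 * |Real.sin (Real.pi * t.valMinAbs / N)| := by gcongr

theorem norm_cyclicDirichlet_le (s : ℕ) {t : ZMod N} (ht : t ≠ 0) :
    ‖cyclicDirichlet N s t‖ ≤ N / (2 * t.valMinAbs.natAbs) := by
  have hN : (0 : ℝ) < N := Nat.cast_pos.2 (NeZero.pos N)
  have hv : (0 : ℝ) < t.valMinAbs.natAbs := Nat.cast_pos.2 (natAbs_valMinAbs_pos ht)
  have hden := four_mul_div_le_norm_stdAddChar_sub_one t
  have hpos : 0 < ‖(ZMod.stdAddChar t : ℂ) - 1‖ := lt_of_lt_of_le (by positivity) hden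
  have hnum : ‖(ZMod.stdAddChar t : ℂ) ^ s - 1‖ ≤ 2 := by
    refine (norm_sub_le _ _).trans_eq ?_
    rw [norm_pow, AddChar.norm_apply, one_pow, norm_one, one_add_one_eq_two]
  rw [cyclicDirichlet, geom_sum_eq (sub_ne_zero.1 (norm_pos_iff.1 hpos)), norm_div]
  calc ‖(ZMod.stdAddChar t : ℂ) ^ s - 1‖ / ‖(ZMod.stdAddChar t : ℂ) - 1‖
      ≤ 2 / (4 * t.valMinAbs.natAbs / N) := by gcongr
    _ = N / (2 * t.valMinAbs.natAbs) := by
        field_simp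
        norm_num

theorem rpow_neg_le_mul_rpow_sub_rpow {q v : ℝ} (hq0 : 0 ≤ q) (hq1 : q < 1) (hv : 1 ≤ v) :
    v ^ (-q) ≤ 2 / (1 - q) * ((v + 1) ^ (1 - q) - v ^ (1 - q)) := by
  have hq : 0 < 1 - q := sub_pos.2 hq1
  have hv0 : 0 < v := by linarith
  have hv1 : 0 < v + 1 := by linarith
  have hbern : (v / (v + 1)) ^ (1 - q) ≤ 1 - (1 - q) / (v + 1) := by
    have h := rpow_one_add_le_one_add_mul_self (s := -(1 / (v + 1))) (p := 1 - q) (by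
      rw [neg_le_neg_iff, div_le_one (by linarith)]
      linarith) hq.le (by linarith)
    convert h using 1
    · congr 1
      field_simp
      ring
    · ring
  have hdiff : (1 - q) * (v + 1) ^ (-q) ≤ (v + 1) ^ (1 - q) - v ^ (1 - q) := by
    rw [Real.div_rpow hv0.le hv1.le, div_le_iff₀ (by positivity)] at hbern
    have hsplit : (v + 1) ^ (1 - q) / (v + 1) = (v + 1) ^ (-q) := by
      rw [← Real.rpow_sub_one hv1.ne', sub_sub_cancel_left]
    rw [← hsplit]
    linear_combination hbern
  have hdouble : v ^ (-q) ≤ 2 * (v + 1) ^ (-q) := by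
    rw [Real.rpow_neg hv0.le, Real.rpow_neg hv1.le, ← div_eq_mul_inv,
      inv_le_comm₀ (by positivity) (by positivity), inv_div, div_le_iff₀ two_pos]
    calc (v + 1) ^ q ≤ (v * 2) ^ q := by gcongr; linarith
      _ = v ^ q * 2 ^ q := Real.mul_rpow hv0.le two_pos.le
      _ ≤ v ^ q * 2 := by
        gcongr
        exact Real.rpow_le_self_of_one_le one_le_two hq1.le
  calc v ^ (-q) ≤ 2 / (1 - q) * ((1 - q) * (v + 1) ^ (-q)) := by
        rwa [← mul_assoc, div_mul_cancel₀ _ hq.ne']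
    _ ≤ 2 / (1 - q) * ((v + 1) ^ (1 - q) - v ^ (1 - q)) := by gcongr

theorem sum_Ico_rpow_neg_le {q : ℝ} (hq0 : 0 ≤ q) (hq1 : q < 1) {n : ℕ} (hn : 1 ≤ n) :
    ∑ v ∈ Finset.Ico 1 n, (v : ℝ) ^ (-q) ≤ 2 / (1 - q) * ((n : ℝ) ^ (1 - q) - 1) := by
  induction n, hn using Nat.le_induction with
  | base => simp
  | succ n hn ih =>
    have h := rpow_neg_le_mul_rpow_sub_rpow hq0 hq1 (v := n) (by exact_mod_cast hn)
    rw [Finset.sum_Ico_succ_top hn]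
    push_cast
    linarith

theorem sum_natAbs_valMinAbs_rpow_neg_le {q : ℝ} (hq0 : 0 ≤ q) (hq1 : q < 1) :
    ∑ t : ZMod N with t ≠ 0, (t.valMinAbs.natAbs : ℝ) ^ (-q) ≤
      4 / (1 - q) * ((N : ℝ) ^ (1 - q) - 1) := by
  have hval : ∑ t : ZMod N with t ≠ 0, (t.val : ℝ) ^ (-q) =
      ∑ v ∈ Finset.Ico 1 N, (v : ℝ) ^ (-q) := by
    refine Finset.sum_nbij' ZMod.val (fun v => (v : ZMod N)) (fun t ht => ?_) (fun v hv => ?_)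
      (fun t _ => ZMod.natCast_zmod_val t) (fun v hv => ?_) fun _ _ => rfl
    · have := ZMod.val_pos.2 (Finset.mem_filter.1 ht).2
      exact Finset.mem_Ico.2 ⟨this, ZMod.val_lt t⟩
    · obtain ⟨h1, h2⟩ := Finset.mem_Ico.1 hv
      refine Finset.mem_filter.2 ⟨Finset.mem_univ _, ZMod.val_pos.1 ?_⟩
      rw [ZMod.val_cast_of_lt h2]
      exact h1
    · exact ZMod.val_cast_of_lt (Finset.mem_Ico.1 hv).2
  have hneg : ∑ t : ZMod N with t ≠ 0, ((-t).val : ℝ) ^ (-q) =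
      ∑ t : ZMod N with t ≠ 0, (t.val : ℝ) ^ (-q) :=
    Finset.sum_nbij' (-·) (-·) (by simp) (by simp) (by simp) (by simp) (by simp)
  have hmin : ∀ t : ZMod N, t ≠ 0 →
      (t.valMinAbs.natAbs : ℝ) ^ (-q) ≤ (t.val : ℝ) ^ (-q) + ((-t).val : ℝ) ^ (-q) := by
    intro t ht
    rw [ZMod.valMinAbs_natAbs_eq_min, show N - t.val = (-t).val by rw [ZMod.neg_val, if_neg ht]]
    rcases min_choice t.val (-t).val with h | h <;> rw [h]
    · exact le_add_of_nonneg_right (by positivity)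
    · exact le_add_of_nonneg_left (by positivity)
  calc ∑ t : ZMod N with t ≠ 0, (t.valMinAbs.natAbs : ℝ) ^ (-q)
      ≤ ∑ t : ZMod N with t ≠ 0, ((t.val : ℝ) ^ (-q) + ((-t).val : ℝ) ^ (-q)) :=
        Finset.sum_le_sum fun t ht => hmin t (Finset.mem_filter.1 ht).2
    _ = 2 * ∑ v ∈ Finset.Ico 1 N, (v : ℝ) ^ (-q) := by
        rw [Finset.sum_add_distrib, hneg, hval, two_mul]
    _ ≤ 2 * (2 / (1 - q) * ((N : ℝ) ^ (1 - q) - 1)) := by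
        gcongr
        exact sum_Ico_rpow_neg_le hq0 hq1 (NeZero.one_le)
    _ = 4 / (1 - q) * ((N : ℝ) ^ (1 - q) - 1) := by ring

end CyclicKernel

section KernelEstimates

variable {m : ℕ → ℕ} [∀ j, NeZero (m j)]

theorem exists_mul_M_add_eq {n K : ℕ} (hn : n < M m (K + 1)) :
    ∃ s < m K, ∃ i < M m K, n = s * M m K + i :=
  ⟨n / M m K, Nat.div_lt_of_lt_mul (by rwa [M, mul_comm] at hn), n % M m K,
    Nat.mod_lt _ (M_pos m K), (Nat.div_add_mod' _ _).symm⟩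

theorem norm_dirichlet_le_div_of_lt (hm : ∀ j, 2 ≤ m j) {k n : ℕ} {x : Group m}
    (hx : x ∈ interval m k 0) (hxk : x k ≠ 0) (hn : n < M m (k + 1)) :
    ‖dirichlet m n x‖ ≤ M m (k + 1) / (x k).valMinAbs.natAbs := by
  obtain ⟨s, hs, i, hi, rfl⟩ := exists_mul_M_add_eq hn
  have hv : (0 : ℝ) < (x k).valMinAbs.natAbs := Nat.cast_pos.2 (natAbs_valMinAbs_pos hxk)
  have hmk : 1 ≤ (m k : ℝ) / (2 * (x k).valMinAbs.natAbs) := by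
    rw [one_le_div (by positivity)]
    exact_mod_cast two_mul_natAbs_valMinAbs_le (x k)
  have hi' : ‖dirichlet m i x‖ ≤ M m k :=
    (norm_dirichlet_le i x).trans (by exact_mod_cast hi.le)
  rw [dirichlet_mul_M_add hm hs hi, dirichlet_M hm, Set.indicator_of_mem hx]
  calc ‖cyclicDirichlet (m k) s (x k) * M m k + rademacher m k x ^ s * dirichlet m i x‖
      ≤ ‖cyclicDirichlet (m k) s (x k)‖ * M m k + ‖dirichlet m i x‖ := by
        refine (norm_add_le _ _).trans_eq ?_
        rw [norm_mul, norm_mul, norm_pow, norm_rademacher, one_pow, one_mul,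
          Complex.norm_natCast]
    _ ≤ m k / (2 * (x k).valMinAbs.natAbs) * M m k +
          m k / (2 * (x k).valMinAbs.natAbs) * M m k := by
        gcongr
        · exact norm_cyclicDirichlet_le s hxk
        · exact hi'.trans (le_mul_of_one_le_left (Nat.cast_nonneg _) hmk)
    _ = M m (k + 1) / (x k).valMinAbs.natAbs := by
        rw [M]
        push_cast
        field_simp
        ring

theorem norm_dirichlet_le_div (hm : ∀ j, 2 ≤ m j) {k : ℕ} {x : Group m}
    (hx : x ∈ interval m k 0) (hxk : x k ≠ 0) (n : ℕ) :
    ‖dirichlet m n x‖ ≤ M m (k + 1) / (x k).valMinAbs.natAbs := by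
  have hlt : ∀ K, k + 1 ≤ K → ∀ n < M m K,
      ‖dirichlet m n x‖ ≤ M m (k + 1) / (x k).valMinAbs.natAbs := by
    intro K hK
    induction K, hK using Nat.le_induction with
    | base => exact fun n hn => norm_dirichlet_le_div_of_lt hm hx hxk hn
    | succ K hK ih =>
      intro n hn
      obtain ⟨s, hs, i, hi, rfl⟩ := exists_mul_M_add_eq hn
      have hxK : x ∉ interval m K 0 := fun h => hxk (h k hK)
      rw [dirichlet_mul_M_add hm hs hi, dirichlet_M hm, Set.indicator_of_notMem hxK, mul_zero,
        zero_add, norm_mul, norm_pow, norm_rademacher, one_pow, one_mul]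
      exact ih i hi
  exact hlt (max (k + 1) n) (le_max_left _ _) n
    ((le_max_right _ _).trans_lt (lt_M hm _))

end KernelEstimates

section KernelIntegral

variable {m : ℕ → ℕ} {p q : ℝ}

theorem mem_interval_succ_single {k : ℕ} {t : ZMod (m k)} {x : Group m} :
    x ∈ interval m (k + 1) (Pi.single k t) ↔ x ∈ interval m k 0 ∧ x k = t := by
  have hsingle : ∀ j < k, (Pi.single k t : Group m) j = 0 := fun j hj =>
    by rw [Pi.single_eq_of_ne hj.ne]
  refine Nat.forall_lt_succ_right.trans (and_congr (forall₂_congr fun j hj => ?_) ?_)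
  · rw [hsingle j hj, Pi.zero_apply]
  · rw [Pi.single_eq_same]

variable [∀ j, NeZero (m j)]

theorem enorm_dirichlet_rpow_le (hm : ∀ j, 2 ≤ m j) (hq : 0 ≤ q) (hqp : q ≤ p) {k : ℕ}
    {x : Group m} (hx : x ∈ interval m k 0) (hxk : x k ≠ 0) (n : ℕ) :
    ‖dirichlet m n x‖ₑ ^ p ≤ ENNReal.ofReal
      ((n : ℝ) ^ (p - q) * (M m (k + 1) : ℝ) ^ q * ((x k).valMinAbs.natAbs : ℝ) ^ (-q)) := by
  rw [← ofReal_norm, ENNReal.ofReal_rpow_of_nonneg (norm_nonneg _) (hq.trans hqp)]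
  refine ENNReal.ofReal_le_ofReal ?_
  calc ‖dirichlet m n x‖ ^ p = ‖dirichlet m n x‖ ^ (p - q) * ‖dirichlet m n x‖ ^ q := by
        rw [← Real.rpow_add_of_nonneg (norm_nonneg _) (sub_nonneg.2 hqp) hq, sub_add_cancel]
    _ ≤ (n : ℝ) ^ (p - q) * ((M m (k + 1) : ℝ) / (x k).valMinAbs.natAbs) ^ q := by
        have := sub_nonneg.2 hqp
        gcongr
        · exact norm_dirichlet_le n x
        · exact norm_dirichlet_le_div hm hx hxk n
    _ = (n : ℝ) ^ (p - q) * (M m (k + 1) : ℝ) ^ q * ((x k).valMinAbs.natAbs : ℝ) ^ (-q) := by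
        rw [Real.div_rpow (Nat.cast_nonneg _) (Nat.cast_nonneg _),
          Real.rpow_neg (Nat.cast_nonneg _), mul_div_assoc', div_eq_mul_inv]

theorem setLIntegral_interval_single_le (hm : ∀ j, 2 ≤ m j) (hq : 0 ≤ q) (hqp : q ≤ p) (n k : ℕ)
    {t : ZMod (m k)} (ht : t ≠ 0) :
    ∫⁻ x in interval m (k + 1) (Pi.single k t), ‖dirichlet m n x‖ₑ ^ p ∂(haar m) ≤
      ENNReal.ofReal ((n : ℝ) ^ (p - q) * (M m (k + 1) : ℝ) ^ (q - 1) *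
        (t.valMinAbs.natAbs : ℝ) ^ (-q)) := by
  have hM : (0 : ℝ) < M m (k + 1) := Nat.cast_pos.2 (M_pos m _)
  calc ∫⁻ x in interval m (k + 1) (Pi.single k t), ‖dirichlet m n x‖ₑ ^ p ∂(haar m)
      ≤ ∫⁻ _ in interval m (k + 1) (Pi.single k t), ENNReal.ofReal ((n : ℝ) ^ (p - q) *
          (M m (k + 1) : ℝ) ^ q * (t.valMinAbs.natAbs : ℝ) ^ (-q)) ∂(haar m) := by
        refine setLIntegral_mono' (measurableSet_interval m _ _) fun x hx => ?_
        obtain ⟨hx0, rfl⟩ := mem_interval_succ_single.1 hx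
        exact enorm_dirichlet_rpow_le hm hq hqp hx0 ht n
    _ = ENNReal.ofReal ((n : ℝ) ^ (p - q) * (M m (k + 1) : ℝ) ^ (q - 1) *
          (t.valMinAbs.natAbs : ℝ) ^ (-q)) := by
        rw [setLIntegral_const, haar_interval, ← ENNReal.ofReal_natCast,
          ← ENNReal.ofReal_inv_of_pos hM, ← ENNReal.ofReal_mul (by positivity),
          Real.rpow_sub_one hM.ne']
        congr 1
        ring

theorem setLIntegral_interval_sdiff (F : Group m → ℝ≥0∞) (k : ℕ) :
    ∫⁻ x in interval m k 0 \ interval m (k + 1) 0, F x ∂(haar m) =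
      ∑ t : ZMod (m k) with t ≠ 0,
        ∫⁻ x in interval m (k + 1) (Pi.single k t), F x ∂(haar m) := by
  have hunion : interval m k 0 \ interval m (k + 1) 0 =
      ⋃ t ∈ Finset.univ.filter fun t : ZMod (m k) => t ≠ 0, interval m (k + 1) (Pi.single k t) := by
    ext x
    have hzero : x ∈ interval m (k + 1) 0 ↔ x ∈ interval m k 0 ∧ x k = 0 :=
      Nat.forall_lt_succ_right
    simp only [Set.mem_sdiff, hzero, Set.mem_iUnion, mem_interval_succ_single, Finset.mem_filter,
      Finset.mem_univ, true_and, exists_prop]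
    aesop
  have hdisj : Set.PairwiseDisjoint (Finset.univ.filter fun t : ZMod (m k) => t ≠ 0)
      fun t => interval m (k + 1) (Pi.single k t) := fun s _ t _ hst =>
    Set.disjoint_left.2 fun x hs ht => hst <|
      (mem_interval_succ_single.1 hs).2.symm.trans (mem_interval_succ_single.1 ht).2
  rw [hunion, lintegral_biUnion_finset hdisj fun t _ => measurableSet_interval m _ _]

theorem setLIntegral_interval_sdiff_le (hm : ∀ j, 2 ≤ m j) (hq0 : 0 ≤ q)
    (hq1 : q < 1) (hqp : q ≤ p) (n k : ℕ) :
    ∫⁻ x in interval m k 0 \ interval m (k + 1) 0, ‖dirichlet m n x‖ₑ ^ p ∂(haar m) ≤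
      ENNReal.ofReal (4 / (1 - q) * (n : ℝ) ^ (p - q) *
        ((M m k : ℝ) ^ (q - 1) - (M m (k + 1) : ℝ) ^ (q - 1))) := by
  have hpow : (M m (k + 1) : ℝ) ^ (q - 1) * (m k : ℝ) ^ (1 - q) = (M m k : ℝ) ^ (q - 1) := by
    have hmk : (0 : ℝ) < m k := Nat.cast_pos.2 (NeZero.pos _)
    rw [M, Nat.cast_mul, Real.mul_rpow hmk.le (Nat.cast_nonneg _), mul_right_comm,
      ← Real.rpow_add hmk, sub_add_sub_cancel, sub_self, Real.rpow_zero, one_mul]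
  calc ∫⁻ x in interval m k 0 \ interval m (k + 1) 0, ‖dirichlet m n x‖ₑ ^ p ∂(haar m)
      ≤ ∑ t : ZMod (m k) with t ≠ 0, ENNReal.ofReal ((n : ℝ) ^ (p - q) *
          (M m (k + 1) : ℝ) ^ (q - 1) * (t.valMinAbs.natAbs : ℝ) ^ (-q)) := by
        rw [setLIntegral_interval_sdiff]
        exact Finset.sum_le_sum fun t ht =>
          setLIntegral_interval_single_le hm hq0 hqp n k (Finset.mem_filter.1 ht).2
    _ = ENNReal.ofReal ((n : ℝ) ^ (p - q) * (M m (k + 1) : ℝ) ^ (q - 1) *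
          ∑ t : ZMod (m k) with t ≠ 0, (t.valMinAbs.natAbs : ℝ) ^ (-q)) := by
        rw [Finset.mul_sum, ENNReal.ofReal_sum_of_nonneg fun t _ => by positivity]
    _ ≤ ENNReal.ofReal ((n : ℝ) ^ (p - q) * (M m (k + 1) : ℝ) ^ (q - 1) *
          (4 / (1 - q) * ((m k : ℝ) ^ (1 - q) - 1))) := by
        gcongr
        exact sum_natAbs_valMinAbs_rpow_neg_le hq0 hq1
    _ = ENNReal.ofReal (4 / (1 - q) * (n : ℝ) ^ (p - q) *
          ((M m k : ℝ) ^ (q - 1) - (M m (k + 1) : ℝ) ^ (q - 1))) := by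
        rw [← hpow]
        congr 1
        ring

theorem lintegral_enorm_dirichlet_rpow_le_add (hm : ∀ j, 2 ≤ m j) (hq0 : 0 ≤ q) (hq1 : q < 1)
    (hqp : q ≤ p) (n K : ℕ) :
    ∫⁻ x, ‖dirichlet m n x‖ₑ ^ p ∂(haar m) ≤
      ENNReal.ofReal (4 / (1 - q) * (n : ℝ) ^ (p - q) * (1 - (M m K : ℝ) ^ (q - 1))) +
        ∫⁻ x in interval m K 0, ‖dirichlet m n x‖ₑ ^ p ∂(haar m) := by
  have : 0 < 1 - q := sub_pos.2 hq1
  have hM : Antitone fun k => (M m k : ℝ) ^ (q - 1) := fun i j hij =>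
    Real.rpow_le_rpow_of_nonpos (Nat.cast_pos.2 (M_pos m i)) (by exact_mod_cast M_mono m hij)
      (by linarith)
  have hM1 : ∀ k, (M m k : ℝ) ^ (q - 1) ≤ 1 := fun k => by simpa [M] using hM k.zero_le
  induction K with
  | zero => simp [interval, M]
  | succ K ih =>
    have hsub : interval m (K + 1) 0 ⊆ interval m K (0 : Group m) := fun x hx j hj =>
      hx j (hj.trans K.lt_succ_self)
    refine ih.trans ?_
    rw [← lintegral_inter_add_sdiff _ (interval m K 0) (measurableSet_interval m (K + 1) 0),
      Set.inter_eq_self_of_subset_right hsub, add_comm (lintegral _ _), ← add_assoc]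
    gcongr
    refine (add_le_add_right (setLIntegral_interval_sdiff_le hm hq0 hq1 hqp n K) _).trans_eq ?_
    rw [← ENNReal.ofReal_add (mul_nonneg (by positivity) (sub_nonneg.2 (hM1 K)))
      (mul_nonneg (by positivity) (sub_nonneg.2 (hM K.le_succ)))]
    congr 1
    ring

theorem setLIntegral_interval_enorm_dirichlet_rpow_le (hp : 0 ≤ p) (n K : ℕ) (y : Group m) :
    ∫⁻ x in interval m K y, ‖dirichlet m n x‖ₑ ^ p ∂(haar m) ≤
      ENNReal.ofReal ((n : ℝ) ^ p / M m K) := by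
  calc ∫⁻ x in interval m K y, ‖dirichlet m n x‖ₑ ^ p ∂(haar m)
      ≤ ∫⁻ _ in interval m K y, ENNReal.ofReal ((n : ℝ) ^ p) ∂(haar m) := by
        refine setLIntegral_mono' (measurableSet_interval m _ _) fun x _ => ?_
        rw [← ofReal_norm, ENNReal.ofReal_rpow_of_nonneg (norm_nonneg _) hp]
        gcongr
        exact norm_dirichlet_le n x
    _ = ENNReal.ofReal ((n : ℝ) ^ p / M m K) := by
        rw [setLIntegral_const, haar_interval,
          ENNReal.ofReal_div_of_pos (Nat.cast_pos.2 (M_pos m K)), ENNReal.ofReal_natCast,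
          div_eq_mul_inv]

theorem lintegral_enorm_dirichlet_rpow_le (hm : ∀ j, 2 ≤ m j) (hq0 : 0 ≤ q) (hq1 : q < 1)
    (hqp : q ≤ p) {n : ℕ} (hn : 1 ≤ n) :
    ∫⁻ x, ‖dirichlet m n x‖ₑ ^ p ∂(haar m) ≤
      ENNReal.ofReal (5 / (1 - q) * (n : ℝ) ^ (p - q)) := by
  have hq : 0 < 1 - q := sub_pos.2 hq1
  have hn1 : (1 : ℝ) ≤ n := by exact_mod_cast hn
  have hfar : 4 / (1 - q) * (n : ℝ) ^ (p - q) * (1 - (M m n : ℝ) ^ (q - 1)) ≤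
      4 / (1 - q) * (n : ℝ) ^ (p - q) :=
    mul_le_of_le_one_right (by positivity) (sub_le_self _ (by positivity))
  have hnear : (n : ℝ) ^ p / M m n ≤ 1 / (1 - q) * (n : ℝ) ^ (p - q) := by
    have hMn : (n : ℝ) ^ q ≤ M m n :=
      (Real.rpow_le_self_of_one_le hn1 hq1.le).trans (by exact_mod_cast (lt_M hm n).le)
    calc (n : ℝ) ^ p / M m n ≤ (n : ℝ) ^ p / (n : ℝ) ^ q := by gcongr
      _ = (n : ℝ) ^ (p - q) := (Real.rpow_sub (by linarith) p q).symm
      _ ≤ 1 / (1 - q) * (n : ℝ) ^ (p - q) :=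
        le_mul_of_one_le_left (by positivity) (by rw [one_le_div hq]; linarith)
  calc ∫⁻ x, ‖dirichlet m n x‖ₑ ^ p ∂(haar m)
      ≤ ENNReal.ofReal (4 / (1 - q) * (n : ℝ) ^ (p - q)) +
          ENNReal.ofReal (1 / (1 - q) * (n : ℝ) ^ (p - q)) := by
        refine (lintegral_enorm_dirichlet_rpow_le_add hm hq0 hq1 hqp n n).trans ?_
        gcongr
        exact (setLIntegral_interval_enorm_dirichlet_rpow_le (hq0.trans hqp) n n 0).trans
          (ENNReal.ofReal_le_ofReal hnear)
    _ = ENNReal.ofReal (5 / (1 - q) * (n : ℝ) ^ (p - q)) := by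
        rw [← ENNReal.ofReal_add (by positivity) (by positivity)]
        congr 1
        ring

theorem one_le_two_mul_log {n : ℕ} (hn : 2 ≤ n) : 1 ≤ 2 * Real.log n := by
  have h : Real.log 2 ≤ Real.log n := Real.log_le_log two_pos (by exact_mod_cast hn)
  linarith [Real.log_two_gt_d9]

theorem lintegral_enorm_dirichlet_le (hm : ∀ j, 2 ≤ m j) {n : ℕ} (hn : 2 ≤ n) :
    ∫⁻ x, ‖dirichlet m n x‖ₑ ∂(haar m) ≤ ENNReal.ofReal (45 * Real.log n) := by
  have hn0 : (0 : ℝ) < n := by positivity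
  have hlog := one_le_two_mul_log hn
  have hr : 0 < 1 + Real.log n := by linarith
  have hrinv : (1 + Real.log n)⁻¹ ≤ 1 := inv_le_one_of_one_le₀ (by linarith)
  have hpow : (n : ℝ) ^ (1 + Real.log n)⁻¹ ≤ 3 := by
    rw [Real.rpow_def_of_pos hn0]
    calc Real.exp (Real.log n * (1 + Real.log n)⁻¹) ≤ Real.exp 1 := by
          gcongr
          rw [mul_inv_le_iff₀ hr]
          linarith
      _ ≤ 3 := by linarith [Real.exp_one_lt_d9]
  have h := lintegral_enorm_dirichlet_rpow_le (m := m) (p := 1) (q := 1 - (1 + Real.log n)⁻¹) hm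
    (sub_nonneg.2 hrinv) (sub_lt_self _ (inv_pos.2 hr)) (sub_le_self _ (inv_pos.2 hr).le)
    (one_le_two.trans hn)
  simp only [ENNReal.rpow_one, sub_sub_cancel, div_inv_eq_mul] at h
  refine h.trans (ENNReal.ofReal_le_ofReal ?_)
  calc 5 * (1 + Real.log n) * (n : ℝ) ^ (1 + Real.log n)⁻¹ ≤ 5 * (1 + Real.log n) * 3 := by gcongr
    _ ≤ 45 * Real.log n := by linarith

theorem exists_lintegral_enorm_dirichlet_rpow_le (hp0 : 0 ≤ p) (hp1 : p ≤ 1) :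
    ∃ C : ℝ, 0 < C ∧ ∀ (m : ℕ → ℕ) [∀ j, NeZero (m j)], (∀ j, 2 ≤ m j) → ∀ n : ℕ, 2 ≤ n →
      ∫⁻ x, ‖dirichlet m n x‖ₑ ^ p ∂(haar m) ≤ ENNReal.ofReal (C * Real.log n ^ ⌊p⌋₊) := by
  rcases hp1.lt_or_eq with hp | rfl
  · refine ⟨5 / (1 - p), div_pos (by norm_num) (sub_pos.2 hp), fun m _ hm n hn => ?_⟩
    simpa [Nat.floor_eq_zero.2 hp] using
      lintegral_enorm_dirichlet_rpow_le hm hp0 hp le_rfl (one_le_two.trans hn)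
  · refine ⟨45, by norm_num, fun m _ hm n hn => ?_⟩
    simpa using lintegral_enorm_dirichlet_le hm hn

end KernelIntegral

section Approximation

variable {p : ℝ}

theorem pow_floor_rpow_one_div (hp1 : p ≤ 1) (a : ℝ) :
    (a ^ ⌊p⌋₊) ^ (1 / p) = a ^ ⌊p⌋₊ := by
  rcases hp1.lt_or_eq with hp | rfl
  · rw [Nat.floor_eq_zero.2 hp, pow_zero, Real.one_rpow]
  · rw [one_div_one, Real.rpow_one]

theorem one_le_two_mul_pow_floor (hp1 : p ≤ 1) {a : ℝ} (ha : 1 ≤ 2 * a) :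
    1 ≤ 2 * a ^ ⌊p⌋₊ := by
  rcases hp1.lt_or_eq with hp | rfl
  · simp [Nat.floor_eq_zero.2 hp]
  · simpa using ha

theorem rpow_one_sub_mul_add_one_rpow_le (hp0 : 0 < p) (hp1 : p ≤ 1) {C N a : ℝ} (hC : 0 ≤ C)
    (hN : 1 ≤ N) (ha : 1 ≤ 2 * a) :
    (N ^ (1 - p) * (C * a ^ ⌊p⌋₊) + 1) ^ (1 / p) ≤
      (C + 2) ^ (1 / p) * N ^ (1 / p - 1) * a ^ ⌊p⌋₊ := by
  have ha0 : 0 < a := by linarith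
  have hN0 : 0 < N := by linarith
  have hNp : 1 ≤ N ^ (1 - p) := Real.one_le_rpow hN (sub_nonneg.2 hp1)
  have hone : 1 ≤ N ^ (1 - p) * (2 * a ^ ⌊p⌋₊) :=
    one_le_mul_of_one_le_of_one_le hNp (one_le_two_mul_pow_floor hp1 ha)
  calc (N ^ (1 - p) * (C * a ^ ⌊p⌋₊) + 1) ^ (1 / p)
      ≤ ((C + 2) * N ^ (1 - p) * a ^ ⌊p⌋₊) ^ (1 / p) := by
        gcongr
        linarith
    _ = (C + 2) ^ (1 / p) * N ^ (1 / p - 1) * a ^ ⌊p⌋₊ := by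
        rw [Real.mul_rpow (by positivity) (by positivity),
          Real.mul_rpow (by positivity) (by positivity), pow_floor_rpow_one_div hp1,
          ← Real.rpow_mul hN0.le, mul_one_div, sub_div, div_self hp0.ne']

theorem exists_rpow_mul_lintegral_dirichlet_add_one_le (hp0 : 0 < p) (hp1 : p ≤ 1) :
    ∃ c : ℝ, 0 < c ∧ ∀ (m : ℕ → ℕ) [∀ j, NeZero (m j)], (∀ j, 2 ≤ m j) →
      ∀ N n : ℕ, 1 ≤ N → 2 ≤ n →
        ((N : ℝ≥0∞) ^ (1 - p) * (∫⁻ x, ‖dirichlet m n x‖ₑ ^ p ∂(haar m)) + 1) ^ (1 / p) ≤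
          ENNReal.ofReal (c * (N : ℝ) ^ (1 / p - 1) * Real.log n ^ ⌊p⌋₊) := by
  obtain ⟨C, hC, hkernel⟩ := exists_lintegral_enorm_dirichlet_rpow_le hp0.le hp1
  refine ⟨(C + 2) ^ (1 / p), by positivity, fun m _ hm N n hN hn => ?_⟩
  have hlog := one_le_two_mul_log hn
  have : 0 ≤ Real.log n := by linarith
  calc ((N : ℝ≥0∞) ^ (1 - p) * (∫⁻ x, ‖dirichlet m n x‖ₑ ^ p ∂(haar m)) + 1) ^ (1 / p)
      ≤ ((N : ℝ≥0∞) ^ (1 - p) * ENNReal.ofReal (C * Real.log n ^ ⌊p⌋₊) + 1) ^ (1 / p) := by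
        gcongr
        exact hkernel m hm n hn
    _ = ENNReal.ofReal (((N : ℝ) ^ (1 - p) * (C * Real.log n ^ ⌊p⌋₊) + 1) ^ (1 / p)) := by
        rw [← ENNReal.ofReal_natCast,
          ENNReal.ofReal_rpow_of_nonneg (by positivity) (sub_nonneg.2 hp1),
          ← ENNReal.ofReal_mul (by positivity), ← ENNReal.ofReal_one,
          ← ENNReal.ofReal_add (by positivity) zero_le_one,
          ENNReal.ofReal_rpow_of_nonneg (by positivity) (by positivity)]
    _ ≤ ENNReal.ofReal ((C + 2) ^ (1 / p) * (N : ℝ) ^ (1 / p - 1) * Real.log n ^ ⌊p⌋₊) :=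
        ENNReal.ofReal_le_ofReal
          (rpow_one_sub_mul_add_one_rpow_le hp0 hp1 hC.le (by exact_mod_cast hN) hlog)

theorem M_succ_rpow_le (hp0 : 0 < p) (hp1 : p ≤ 1) {m : ℕ → ℕ} {B k n : ℕ}
    (hB : p < 1 → m k ≤ B) (hkn : M m k ≤ n) :
    (M m (k + 1) : ℝ) ^ (1 / p - 1) ≤ (B + 1 : ℝ) ^ (1 / p - 1) * (n : ℝ) ^ (1 / p - 1) := by
  rcases hp1.lt_or_eq with hp | rfl
  · have hMB : (M m (k + 1) : ℝ) ≤ (B + 1) * n := by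
      exact_mod_cast Nat.mul_le_mul ((hB hp).trans B.le_succ) hkn
    rw [← Real.mul_rpow (by positivity) (by positivity)]
    exact Real.rpow_le_rpow (by positivity) hMB (sub_nonneg.2 (one_le_one_div hp0 hp1))
  · simp

end Approximation

end Vilenkin

theorem theorem2_general (p : ℝ) (hp0 : 0 < p) (hp1 : p ≤ 1) :
    ∃ c : ℝ, 0 < c ∧
      ∀ (m : ℕ → ℕ) [∀ j, NeZero (m j)], (∀ j, 2 ≤ m j) →
        ∀ f : ℕ → Vilenkin.Group m → ℂ, Martingale f (Vilenkin.filtration m) (Vilenkin.haar m) →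
          ∀ k n : ℕ, Vilenkin.M m k < n → n ≤ Vilenkin.M m (k + 1) →
            Vilenkin.hardyNorm m p
                (Vilenkin.toMartingale m (Vilenkin.martingalePartialSum m n f) - f) ≤
              ENNReal.ofReal
                  (c * (Vilenkin.M m (k + 1) : ℝ) ^ (1 / p - 1) * Real.log n ^ ⌊p⌋₊) *
                Vilenkin.modulus m p k f := by
  obtain ⟨c, hc, hkernel⟩ :=
    Vilenkin.exists_rpow_mul_lintegral_dirichlet_add_one_le hp0 hp1
  refine ⟨c, hc, fun m _ hm f hf k n hkn hnk => ?_⟩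
  refine (Vilenkin.hardyNorm_toMartingale_sub_le hm hp0 hp1 hf hkn.le hnk).trans ?_
  gcongr
  exact hkernel m hm _ n (Vilenkin.M_pos m _) ((Nat.succ_le_succ (Vilenkin.M_pos m k)).trans hkn)

theorem theorem2 (p : ℝ) (hp0 : 0 < p) (hp1 : p ≤ 1) (B : ℕ) :
    ∃ c : ℝ, 0 < c ∧
      ∀ (m : ℕ → ℕ) [∀ j, NeZero (m j)], (∀ j, 2 ≤ m j) → (p < 1 → ∀ j, m j ≤ B) →
        ∀ f : ℕ → Vilenkin.Group m → ℂ, Vilenkin.MemHardy m p f →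
          ∀ k n : ℕ, Vilenkin.M m k < n → n ≤ Vilenkin.M m (k + 1) →
            Vilenkin.hardyNorm m p
                (Vilenkin.toMartingale m (Vilenkin.martingalePartialSum m n f) - f) ≤
              ENNReal.ofReal (c * (n : ℝ) ^ (1 / p - 1) * Real.log n ^ ⌊p⌋₊) *
                Vilenkin.modulus m p k f := by
  obtain ⟨c, hc, h⟩ := theorem2_general p hp0 hp1
  refine ⟨c * (B + 1 : ℝ) ^ (1 / p - 1), by positivity, fun m _ hm hB f hf k n hkn hnk =>
    (h m hm f hf.1 k n hkn hnk).trans ?_⟩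
  have hM := Vilenkin.M_succ_rpow_le hp0 hp1 (fun hp => hB hp k) hkn.le
  rw [mul_assoc c ((B + 1 : ℝ) ^ (1 / p - 1))]
  gcongr
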